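/- For integers $n, m \ge 1$, a set $A \subseteq \{0,1\}^n$ and a (possibly partial) function $f : A \to \{0,1\}^m$, let $E(f) = \sum_{y \in f(A)} p_y \log_2 \frac{1}{p_y}$, where $p_y = \Pr[f(X) = y]$ for $X$ uniform in $A$, be the Shannon entropy of $f(X)$. A $T$-query quantum decision tree algorithm acts on an $n$-bit input register, a query register consisting of a $\lceil \log_2 n\rceil$-bit pointer and one answer bit, and a working register with an arbitrary finite number of bits. On input $x$ it applies $U_T O U_{T-1} O \cdots O U_0$ to $|x\rangle|\vec 0\rangle$, where $O$ maps $|x\rangle|i,b\rangle|c\rangle$ to $|x\rangle|i, b \oplus x_i\rangle|c\rangle$ (a pointer that addresses no input position leaves the state unchanged) and each $U_t$ is the identity on the input register tensored with a unitary operator on the query and working registers. It computes $f$ if there is a measurement of the query and working registers that, for every $x \in A$, yields the outcome $f(x)$ with probability at least $2/3$. Let $Q(f)$ be the least $T$ for which some $T$-query algorithm computes $f$. Then $Q(f) = \Omega(E(f)/\log n)$; that is, there is an absolute constant $c > 0$ such that for all $n \ge 2$, all $m$, all $A$ and all $f$, $$Q(f) \ge c \cdot \frac{E(f)}{\log_2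 n}.$$ -/

import Mathlib

open scoped Kronecker ComplexOrder

namespace QuantumDecisionTree

/-- Bit strings of length `n`. -/
abbrev Bits (n : ℕ) : Type := Fin n → Bool

/-- Computational basis labels `(i, b)` of the query register: a pointer `i`, stored in
`⌈log₂ n⌉` bits and read as an integer in `{0, …, 2 ^ ⌈log₂ n⌉ - 1}`, and one answer bit `b`. -/
abbrev QueryReg (n : ℕ) : Type := Fin (2 ^ Nat.clog 2 n) × Bool

/-- Computational basis labels `((i, b), c)` of the query register together with a working
register of `r` bits. -/
abbrev CompReg (n r : ℕ) : Type := QueryReg n × Bits r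

/-- Computational basis labels `(x, ((i, b), c))` of all registers, the input register included. -/
abbrev FullReg (n r : ℕ) : Type := Bits n × CompReg n r

/-- The input bit addressed by the pointer `i` (input positions are numbered from `0`).
A pointer that addresses no input position reads the bit `0`. -/
def addressedBit {n : ℕ} (x : Bits n) (i : Fin (2 ^ Nat.clog 2 n)) : Bool :=
  if h : i.val < n then x ⟨i.val, h⟩ else false

/-- The action `|x⟩|i, b⟩|c⟩ ↦ |x⟩|i, b ⊕ x_i⟩|c⟩` of the oracle gate on basis labels. -/
def oracleMap {n r : ℕ} (s : FullReg n r) : FullReg n r :=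
  (s.1, ((s.2.1.1, xor s.2.1.2 (addressedBit s.1 s.2.1.1)), s.2.2))

/-- The oracle gate `O`. -/
def oracleGate (n r : ℕ) : Matrix (FullReg n r) (FullReg n r) ℂ :=
  Matrix.of fun s s' => if s = oracleMap s' then 1 else 0

/-- The operator `I ⊗ V` on all registers, for `V` acting on the computer's registers. -/
def onComp {n r : ℕ} (V : Matrix (CompReg n r) (CompReg n r) ℂ) :
    Matrix (FullReg n r) (FullReg n r) ℂ :=
  (1 : Matrix (Bits n) (Bits n) ℂ) ⊗ₖ V

/-- The all-zero label of the computer's registers. -/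
def zeroComp (n r : ℕ) : CompReg n r :=
  ((⟨0, Nat.two_pow_pos _⟩, false), fun _ => false)

/-- The state `U_t O U_{t-1} O ⋯ O U_0 |x⟩|0⟩`, where `U_s = I ⊗ U s`. -/
noncomputable def stateAfter {n r : ℕ} (U : ℕ → Matrix.unitaryGroup (CompReg n r) ℂ)
    (x : Bits n) : ℕ → (FullReg n r → ℂ)
  | 0 => (onComp (U 0).1).mulVec (Pi.single (x, zeroComp n r) 1)
  | t + 1 => (onComp (U (t + 1)).1).mulVec ((oracleGate n r).mulVec (stateAfter U x t))

/-- `M` is a quantum measurement (a positive operator valued measure) on the computer's registers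
with outcomes in `{0, 1}^m`. -/
def IsMeasurement {n r m : ℕ} (M : Bits m → Matrix (CompReg n r) (CompReg n r) ℂ) : Prop :=
  (∀ y, (M y).PosSemidef) ∧ ∑ y, M y = 1

/-- The probability of the outcome `y` when the measurement `M` is applied to the computer's
registers in the state `ψ`. -/
noncomputable def outcomeProb {n r m : ℕ}
    (M : Bits m → Matrix (CompReg n r) (CompReg n r) ℂ) (ψ : FullReg n r → ℂ)
    (y : Bits m) : ℝ :=
  (star ψ ⬝ᵥ (onComp (M y)).mulVec ψ).re

/-- Some quantum decision tree algorithm, with a working register of any finite size,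
computes the (possibly partial) function `f` in `T` queries with error at most `1/3`.
Only `U 0, …, U T` are used. -/
def ComputableIn {n m : ℕ} {A : Finset (Bits n)} (f : A → Bits m) (T : ℕ) : Prop :=
  ∃ (r : ℕ) (U : ℕ → Matrix.unitaryGroup (CompReg n r) ℂ)
    (M : Bits m → Matrix (CompReg n r) (CompReg n r) ℂ),
    IsMeasurement M ∧
      ∀ x : A, 2 / 3 ≤ outcomeProb M (stateAfter U x.1 T) (f x)

/-- The quantum decision tree complexity of `f` with error at most `1/3`: the minimal number of
queries. -/
noncomputable def queryComplexity {n m : ℕ} {A : Finset (Bits n)} (f : A → Bits m) : ℕ∞ :=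
  ⨅ (T : ℕ) (_ : ComputableIn f T), (T : ℕ∞)

/-- The probability `p_y` that `f X = y`, for `X` uniform in the domain `A` of `f`. -/
noncomputable def valueProb {n m : ℕ} {A : Finset (Bits n)} (f : A → Bits m) (y : Bits m) : ℝ :=
  ((Finset.univ.filter fun x : A => f x = y).card : ℝ) / (A.card : ℝ)

/-- The Shannon entropy (in bits) of `f X`, for `X` uniform in the domain `A` of `f`. -/
noncomputable def entropy {n m : ℕ} {A : Finset (Bits n)} (f : A → Bits m) : ℝ :=
  ∑ y ∈ Finset.univ.image f, valueProb f y * Real.logb 2 (1 / valueProb f y)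

end QuantumDecisionTree

/-!
A lower bound by counting dimensions. For a fixed input `x`, the oracle acts on the computer's
registers as `1 + ∑ i, [x i] • B i`, where the operators `B i` do not depend on `x`. Expanding the
product `U_T O U_{T-1} ⋯ O U_0`, the final states for all inputs lie in the span of at most
`(n + 1) ^ T` vectors that depend on the algorithm only (`exists_spanning_finset`).

Pick one input for each value of `f`, and let `ψ y` be the final state for the input chosen for `y`.
For unit vectors `ψ y` in a subspace `W` and any measurement `M`, each `⟨ψ y, M y (ψ y)⟩` is at most
the trace of the compression of `M y` to `W`; since `∑ y, M y = 1`, the success probabilities add up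
to at most `dim W` (`sum_measurement_le_finrank`). Hence `2/3 * |f(A)| ≤ (n + 1) ^ T`
(`card_image_le`), which bounds the number of values, and so also the entropy, since
`entropy f ≤ log₂ |f(A)|` by Jensen's inequality (`entropy_le_logb_card_image`).
-/

namespace QuantumDecisionTree

/-! ### Measurements on states in a subspace -/

section Measurement

open Matrix
open scoped MatrixOrder

/-- The squared norm of a linear map at a unit vector is at most its squared Hilbert–Schmidt norm
on a subspace containing the vector. -/
lemma norm_sq_le_sum_norm_sq_basis {E F κ : Type*} [NormedAddCommGroup E] [InnerProductSpace ℂ E]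
    [NormedAddCommGroup F] [InnerProductSpace ℂ F] [Fintype κ] {W : Submodule ℂ E}
    (b : OrthonormalBasis κ ℂ W) (L : E →ₗ[ℂ] F) {ψ : E} (hψ : ψ ∈ W) (hnorm : ‖ψ‖ = 1) :
    ‖L ψ‖ ^ 2 ≤ ∑ k, ‖L (b k)‖ ^ 2 := by
  have hexp : L ψ = ∑ k, inner ℂ (b k) (⟨ψ, hψ⟩ : W) • L (b k) := by
    have h := congrArg (fun w : W => L (w : E)) (b.sum_repr' ⟨ψ, hψ⟩)
    simpa [map_sum] using h.symm
  have hcoef : ∑ k, ‖inner ℂ (b k) (⟨ψ, hψ⟩ : W)‖ ^ 2 = 1 := by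
    rw [b.sum_sq_norm_inner_right]
    simp [hnorm]
  calc ‖L ψ‖ ^ 2 ≤ (∑ k, ‖inner ℂ (b k) (⟨ψ, hψ⟩ : W)‖ * ‖L (b k)‖) ^ 2 := by
        rw [hexp]
        gcongr
        exact (norm_sum_le _ _).trans_eq (Finset.sum_congr rfl fun k _ => norm_smul _ _)
    _ ≤ (∑ k, ‖inner ℂ (b k) (⟨ψ, hψ⟩ : W)‖ ^ 2) * ∑ k, ‖L (b k)‖ ^ 2 :=
        Finset.sum_mul_sq_le_sq_mul_sq _ _ _
    _ = ∑ k, ‖L (b k)‖ ^ 2 := by rw [hcoef, one_mul]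

lemma re_star_dotProduct_self {ι : Type*} [Fintype ι] (v : EuclideanSpace ℂ ι) :
    (star v.ofLp ⬝ᵥ v.ofLp).re = ‖v‖ ^ 2 := by
  rw [EuclideanSpace.norm_sq_eq]
  simp [dotProduct, Complex.sq_norm, Complex.normSq_apply]

/-- Unit vectors in a subspace `W` are identified by a measurement with probabilities that add up
to at most `dim W`. -/
lemma sum_measurement_le_finrank {ι Y : Type*} [Fintype ι] [DecidableEq ι] [Fintype Y]
    (M : Y → Matrix ι ι ℂ) (hM : ∀ y, (M y).PosSemidef) (hsum : ∑ y, M y = 1)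
    (W : Submodule ℂ (ι → ℂ)) (S : Finset Y) (ψ : Y → ι → ℂ) (hψ : ∀ y ∈ S, ψ y ∈ W)
    (hnorm : ∀ y ∈ S, star (ψ y) ⬝ᵥ ψ y = 1) :
    ∑ y ∈ S, (star (ψ y) ⬝ᵥ M y *ᵥ ψ y).re ≤ Module.finrank ℂ W := by
  let e := WithLp.linearEquiv 2 ℂ (ι → ℂ)
  let W' : Submodule ℂ (EuclideanSpace ℂ ι) := W.map e.symm.toLinearMap
  have hfin : Module.finrank ℂ W' = Module.finrank ℂ W := e.symm.finrank_map_eq W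
  let b := stdOrthonormalBasis ℂ W'
  let v : Fin (Module.finrank ℂ W') → EuclideanSpace ℂ ι := fun k => (b k : EuclideanSpace ℂ ι)
  -- Writing `M y = Bᴴ * B` turns the quadratic form of `M y` into a squared norm.
  have hsq : ∀ y, ∃ L : EuclideanSpace ℂ ι →ₗ[ℂ] EuclideanSpace ℂ ι,
      ∀ u : ι → ℂ, (star u ⬝ᵥ M y *ᵥ u).re = ‖L (WithLp.toLp 2 u)‖ ^ 2 := by
    intro y
    obtain ⟨B, hB⟩ : ∃ B : Matrix ι ι ℂ, M y = Bᴴ * B := by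
      have hherm : (CFC.sqrt (M y))ᴴ = CFC.sqrt (M y) := (CFC.sqrt_nonneg (M y)).posSemidef.1
      refine ⟨CFC.sqrt (M y), ?_⟩
      rw [hherm, CFC.sqrt_mul_sqrt_self (M y) (hM y).nonneg]
    refine ⟨B.toEuclideanLin, fun u => ?_⟩
    rw [← re_star_dotProduct_self, hB, ← mulVec_mulVec, dotProduct_mulVec, ← star_mulVec]
    rfl
  have hle : ∀ y ∈ S, (star (ψ y) ⬝ᵥ M y *ᵥ ψ y).re ≤
      ∑ k, (star (v k).ofLp ⬝ᵥ M y *ᵥ (v k).ofLp).re := by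
    intro y hy
    obtain ⟨L, hL⟩ := hsq y
    simp only [hL]
    refine norm_sq_le_sum_norm_sq_basis b L (Submodule.mem_map_of_mem (hψ y hy)) ?_
    have h := re_star_dotProduct_self (WithLp.toLp 2 (ψ y))
    rw [hnorm y hy, Complex.one_re] at h
    exact (pow_eq_one_iff_of_nonneg (norm_nonneg _) two_ne_zero).mp h.symm
  have hone : ∀ k, ∑ y, (star (v k).ofLp ⬝ᵥ M y *ᵥ (v k).ofLp).re = 1 := by
    intro k
    rw [← Complex.re_sum, ← dotProduct_sum, ← sum_mulVec, hsum, one_mulVec,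
      re_star_dotProduct_self]
    have : ‖v k‖ = 1 := b.orthonormal.1 k
    rw [this, one_pow]
  calc ∑ y ∈ S, (star (ψ y) ⬝ᵥ M y *ᵥ ψ y).re
      ≤ ∑ y ∈ S, ∑ k, (star (v k).ofLp ⬝ᵥ M y *ᵥ (v k).ofLp).re := Finset.sum_le_sum hle
    _ ≤ ∑ y, ∑ k, (star (v k).ofLp ⬝ᵥ M y *ᵥ (v k).ofLp).re := by
        refine Finset.sum_le_univ_sum_of_nonneg fun y => Finset.sum_nonneg fun k _ => ?_
        obtain ⟨L, hL⟩ := hsq y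
        rw [hL]
        positivity
    _ = Module.finrank ℂ W := by
        rw [Finset.sum_comm, Finset.sum_congr rfl fun k _ => hone k, ← hfin]
        simp

end Measurement

/-! ### The states of the computer's registers -/

section States

open Matrix

variable {n m r : ℕ}

/-- The oracle for the input `x`, as a map on labels of the computer's registers. -/
def compOracle (x : Bits n) (s : CompReg n r) : CompReg n r :=
  ((s.1.1, xor s.1.2 (addressedBit x s.1.1)), s.2)

lemma compOracle_involutive (x : Bits n) :
    Function.Involutive (compOracle x : CompReg n r → CompReg n r) := by
  intro s
  simp [compOracle]

/-- The state of the computer's registers after `t` queries to the input `x`. The oracle acts by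
composition with `compOracle x`, which is its own inverse. -/
noncomputable def compState (U : ℕ → Matrix.unitaryGroup (CompReg n r) ℂ) (x : Bits n) :
    ℕ → (CompReg n r → ℂ)
  | 0 => (U 0).1 *ᵥ Pi.single (zeroComp n r) 1
  | t + 1 => (U (t + 1)).1 *ᵥ (compState U x t ∘ compOracle x)

/-- The product state `|x⟩ ⊗ v`. -/
noncomputable def withInput (x : Bits n) (v : CompReg n r → ℂ) : FullReg n r → ℂ :=
  fun s => if s.1 = x then v s.2 else 0

lemma onComp_mulVec_withInput (V : Matrix (CompReg n r) (CompReg n r) ℂ) (x : Bits n)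
    (v : CompReg n r → ℂ) : onComp V *ᵥ withInput x v = withInput x (V *ᵥ v) := by
  funext ⟨z, s⟩
  simp only [mulVec, dotProduct, onComp, withInput, kroneckerMap_apply, Fintype.sum_prod_type,
    one_apply]
  by_cases h : z = x <;> simp [h]

lemma oracleGate_mulVec_withInput (x : Bits n) (v : CompReg n r → ℂ) :
    oracleGate n r *ᵥ withInput x v = withInput x (v ∘ compOracle x) := by
  funext ⟨z, s⟩
  have hiff : ∀ s' : FullReg n r, (z, s) = oracleMap s' ↔ s' = (z, compOracle z s) := by
    rintro ⟨z', s'⟩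
    constructor
    · intro h
      obtain ⟨rfl, rfl⟩ := Prod.mk.inj h
      exact congrArg (Prod.mk z) (compOracle_involutive z s').symm
    · intro h
      obtain ⟨rfl, rfl⟩ := Prod.mk.inj h
      exact congrArg (Prod.mk z') (compOracle_involutive z' s).symm
  simp only [mulVec, dotProduct, oracleGate, of_apply, hiff, ite_mul, one_mul, zero_mul,
    Finset.sum_ite_eq', Finset.mem_univ, if_true, withInput, Function.comp_apply]
  by_cases h : z = x
  · subst h; simp
  · simp [h]

lemma stateAfter_eq_withInput (U : ℕ → Matrix.unitaryGroup (CompReg n r) ℂ) (x : Bits n) (t : ℕ) :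
    stateAfter U x t = withInput x (compState U x t) := by
  induction t with
  | zero =>
    have h : (Pi.single (x, zeroComp n r) 1 : FullReg n r → ℂ) =
        withInput x (Pi.single (zeroComp n r) 1) := by
      funext ⟨z, s⟩
      by_cases hz : z = x <;> simp [withInput, Pi.single_apply, hz]
    rw [stateAfter, compState, h, onComp_mulVec_withInput]
  | succ t ih =>
    rw [stateAfter, compState, ih, oracleGate_mulVec_withInput, onComp_mulVec_withInput]

lemma outcomeProb_withInput (M : Bits m → Matrix (CompReg n r) (CompReg n r) ℂ) (x : Bits n)
    (v : CompReg n r → ℂ) (y : Bits m) :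
    outcomeProb M (withInput x v) y = (star v ⬝ᵥ M y *ᵥ v).re := by
  rw [outcomeProb, onComp_mulVec_withInput]
  congr 1
  simp only [dotProduct, Fintype.sum_prod_type, withInput, Pi.star_apply]
  rw [Finset.sum_eq_single x (fun z _ hz => by simp [hz]) (by simp)]
  simp

lemma star_unitary_mulVec_dotProduct_self {ι : Type*} [Fintype ι] [DecidableEq ι]
    (U : Matrix.unitaryGroup ι ℂ) (v : ι → ℂ) :
    star (U.1 *ᵥ v) ⬝ᵥ (U.1 *ᵥ v) = star v ⬝ᵥ v := by
  have hU : U.1ᴴ * U.1 = 1 := Matrix.mem_unitaryGroup_iff'.mp U.2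
  rw [star_mulVec, ← dotProduct_mulVec, mulVec_mulVec, hU, one_mulVec]

lemma star_compState_dotProduct_self (U : ℕ → Matrix.unitaryGroup (CompReg n r) ℂ) (x : Bits n)
    (t : ℕ) : star (compState U x t) ⬝ᵥ compState U x t = 1 := by
  induction t with
  | zero =>
    rw [compState, star_unitary_mulVec_dotProduct_self]
    simp
  | succ t ih =>
    rw [compState, star_unitary_mulVec_dotProduct_self, ← ih]
    exact Equiv.sum_comp (compOracle_involutive x).toPerm
      fun s => star (compState U x t s) * compState U x t s

/-! ### The dimension bound -/

/-- The operators into which the oracle decomposes: the identity for `none`, and for `some i` the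
difference between flipping the answer bit and not flipping it, on the basis states whose pointer
addresses position `i`. -/
noncomputable def oraclePart (o : Option (Fin n)) (v : CompReg n r → ℂ) : CompReg n r → ℂ :=
  match o with
  | none => v
  | some i => fun s => if s.1.1.val = i.val then v ((s.1.1, !s.1.2), s.2) - v s else 0

lemma oraclePart_add (o : Option (Fin n)) (v w : CompReg n r → ℂ) :
    oraclePart o (v + w) = oraclePart o v + oraclePart o w := by
  cases o with
  | none => rfl
  | some i =>
    funext s
    by_cases h : s.1.1.val = i.val
    · simp [oraclePart, h]; ring
    · simp [oraclePart, h]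

lemma oraclePart_smul (o : Option (Fin n)) (c : ℂ) (v : CompReg n r → ℂ) :
    oraclePart o (c • v) = c • oraclePart o v := by
  cases o with
  | none => rfl
  | some i =>
    funext s
    by_cases h : s.1.1.val = i.val
    · simp [oraclePart, h]; ring
    · simp [oraclePart, h]

/-- `oraclePart o` followed by the matrix `V`, as a linear map. -/
noncomputable def oraclePartThen (V : Matrix (CompReg n r) (CompReg n r) ℂ) (o : Option (Fin n)) :
    (CompReg n r → ℂ) →ₗ[ℂ] (CompReg n r → ℂ) :=
  V.mulVecLin ∘ₗ
    { toFun := oraclePart o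
      map_add' := oraclePart_add o
      map_smul' := oraclePart_smul o }

/-- The oracle is an affine function of the bits of the input. -/
lemma comp_compOracle_eq (x : Bits n) (v : CompReg n r → ℂ) :
    v ∘ compOracle x =
      ∑ o : Option (Fin n), (o.elim 1 fun i => if x i then 1 else 0 : ℂ) • oraclePart o v := by
  funext ⟨⟨p, a⟩, c⟩
  rw [Fintype.sum_option]
  simp only [Option.elim, one_smul, Pi.add_apply, Finset.sum_apply, Pi.smul_apply, oraclePart,
    smul_eq_mul, Function.comp_apply]
  by_cases hp : p.val < n
  · rw [Finset.sum_eq_single (⟨p.val, hp⟩ : Fin n)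
      (fun i _ hi => by
        rw [if_neg (c := p.val = i.val) (fun h => hi (Fin.ext h.symm)), mul_zero]) (by simp)]
    cases hx : x ⟨p.val, hp⟩ <;> simp [compOracle, addressedBit, hp, hx]
  · rw [Finset.sum_eq_zero fun i _ => by
      rw [if_neg (c := p.val = i.val) (fun h => hp (h ▸ i.isLt)), mul_zero]]
    simp [compOracle, addressedBit, hp]

lemma exists_spanning_finset (U : ℕ → Matrix.unitaryGroup (CompReg n r) ℂ) (t : ℕ) :
    ∃ s : Finset (CompReg n r → ℂ), s.card ≤ (n + 1) ^ t ∧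
      ∀ x : Bits n, compState U x t ∈ Submodule.span ℂ (s : Set (CompReg n r → ℂ)) := by
  classical
  induction t with
  | zero => exact ⟨{(U 0).1 *ᵥ Pi.single (zeroComp n r) 1}, by simp,
      fun x => Submodule.subset_span (by simp [compState])⟩
  | succ t ih =>
    obtain ⟨s, hcard, hs⟩ := ih
    refine ⟨Finset.image₂ (fun o v => oraclePartThen (U (t + 1)).1 o v) Finset.univ s, ?_, ?_⟩
    · calc _ ≤ (Finset.univ : Finset (Option (Fin n))).card * s.card := Finset.card_image₂_le _ _ _
        _ = (n + 1) * s.card := by simp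
        _ ≤ (n + 1) * (n + 1) ^ t := by gcongr
        _ = (n + 1) ^ (t + 1) := (pow_succ' _ _).symm
    · intro x
      rw [compState, comp_compOracle_eq, mulVec_sum]
      refine Submodule.sum_mem _ fun o _ => ?_
      rw [mulVec_smul]
      refine Submodule.smul_mem _ _ ?_
      have h := Submodule.mem_map_of_mem (f := oraclePartThen (U (t + 1)).1 o) (hs x)
      rw [Submodule.map_span] at h
      refine Submodule.span_mono ?_ h
      rintro _ ⟨v, hv, rfl⟩
      exact Finset.mem_image₂_of_mem (Finset.mem_univ o) hv

/-- A function computable in `T` queries takes at most `3/2 * (n + 1) ^ T` values. -/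
lemma card_image_le {A : Finset (Bits n)} {f : A → Bits m} {T : ℕ} (hf : ComputableIn f T) :
    2 / 3 * ((Finset.univ.image f).card : ℝ) ≤ ((n + 1) ^ T : ℕ) := by
  obtain ⟨r, U, M, ⟨hpos, hsum⟩, hprob⟩ := hf
  obtain ⟨s, hcard, hs⟩ := exists_spanning_finset U T
  have hinv : ∀ y, ∃ x : Bits n, y ∈ Finset.univ.image f → ∃ h : x ∈ A, f ⟨x, h⟩ = y := by
    intro y
    by_cases hy : y ∈ Finset.univ.image f
    · obtain ⟨x, -, hx⟩ := Finset.mem_image.mp hy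
      exact ⟨x.1, fun _ => ⟨x.2, hx⟩⟩
    · exact ⟨fun _ => false, fun h => absurd h hy⟩
  choose g hg using hinv
  calc 2 / 3 * ((Finset.univ.image f).card : ℝ)
      = ∑ y ∈ Finset.univ.image f, (2 / 3 : ℝ) := by
        rw [Finset.sum_const, nsmul_eq_mul, mul_comm]
    _ ≤ ∑ y ∈ Finset.univ.image f,
          (star (compState U (g y) T) ⬝ᵥ M y *ᵥ compState U (g y) T).re := by
        refine Finset.sum_le_sum fun y hy => ?_
        obtain ⟨h, hy'⟩ := hg y hy
        have := hprob ⟨g y, h⟩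
        rwa [hy', stateAfter_eq_withInput, outcomeProb_withInput] at this
    _ ≤ Module.finrank ℂ (Submodule.span ℂ (s : Set (CompReg n r → ℂ))) :=
        sum_measurement_le_finrank M hpos hsum _ _ _ (fun y _ => hs (g y))
          fun y _ => star_compState_dotProduct_self U (g y) T
    _ ≤ ((n + 1) ^ T : ℕ) := by
        exact_mod_cast (finrank_span_finset_le_card s).trans hcard

end States

/-! ### The entropy bound -/

section Entropy

variable {n m : ℕ} {A : Finset (Bits n)}

lemma entropy_le_logb_card_image (f : A → Bits m) :
    entropy f ≤ Real.logb 2 ((Finset.univ.image f).card : ℝ) := by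
  rcases A.eq_empty_or_nonempty with hA | hA
  · subst hA
    simp [entropy]
  have hA0 : (0 : ℝ) < A.card := by exact_mod_cast hA.card_pos
  have hpos : ∀ y ∈ Finset.univ.image f, 0 < valueProb f y := by
    intro y hy
    obtain ⟨x, -, hx⟩ := Finset.mem_image.mp hy
    refine div_pos ?_ hA0
    exact_mod_cast Finset.card_pos.mpr ⟨x, by simp [hx]⟩
  have hone : ∑ y ∈ Finset.univ.image f, valueProb f y = 1 := by
    simp only [valueProb]
    rw [← Finset.sum_div, div_eq_one_iff_eq hA0.ne']
    have h := Finset.card_eq_sum_card_image f (Finset.univ : Finset A)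
    rw [Finset.card_univ, Fintype.card_coe] at h
    exact_mod_cast h.symm
  have hJensen := strictConcaveOn_log_Ioi.concaveOn.le_map_sum
    (t := Finset.univ.image f) (w := valueProb f) (p := fun y => 1 / valueProb f y)
    (fun y hy => (hpos y hy).le) hone (fun y hy => one_div_pos.mpr (hpos y hy))
  simp only [smul_eq_mul] at hJensen
  rw [Finset.sum_congr rfl fun y hy => mul_one_div_cancel (hpos y hy).ne'] at hJensen
  rw [Finset.sum_const, nsmul_eq_mul, mul_one] at hJensen
  have h2 : 0 < Real.log 2 := Real.log_pos one_lt_two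
  simp only [entropy, Real.logb, ← mul_div_assoc]
  rw [← Finset.sum_div]
  gcongr

lemma entropy_le_of_computableIn (hn : 2 ≤ n) {f : A → Bits m} {T : ℕ} (hf : ComputableIn f T) :
    entropy f ≤ 3 * T * Real.logb 2 n := by
  refine (entropy_le_logb_card_image f).trans ?_
  have hcard := card_image_le hf
  set K := (Finset.univ.image f).card
  have hle : K ≤ n ^ (3 * T) := by
    rcases Nat.eq_zero_or_pos T with rfl | hT
    · -- An algorithm without queries computes constant functions only, as `3/2 < 2`.
      have : (K : ℝ) < 2 := by
        rw [pow_zero, Nat.cast_one] at hcard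
        linarith
      have : K < 2 := by exact_mod_cast this
      simpa using Nat.lt_succ_iff.mp this
    · -- The exponent `3 * T` absorbs `n + 1 ≤ n ^ 2` and `3/2 ≤ n ≤ n ^ T`.
      have h1 : 2 * K ≤ 3 * (n + 1) ^ T := by
        have : (2 : ℝ) * K ≤ 3 * ((n + 1) ^ T : ℕ) := by linarith
        exact_mod_cast this
      have h2 : (n + 1) ^ T ≤ n ^ (2 * T) := by
        rw [pow_mul]
        gcongr
        nlinarith
      have h3 : n ≤ n ^ T := Nat.le_self_pow hT.ne' n
      have h4 : n ^ (3 * T) = n ^ T * n ^ (2 * T) := by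
        rw [← pow_add]
        congr 1
        ring
      rw [h4]
      nlinarith [Nat.mul_le_mul_right (n ^ (2 * T)) (hn.trans h3)]
  rcases Nat.eq_zero_or_pos K with hK | hK
  · rw [hK, Nat.cast_zero, Real.logb_zero]
    have : 0 ≤ Real.logb 2 n :=
      Real.logb_nonneg one_lt_two (by exact_mod_cast (one_le_two.trans hn))
    positivity
  calc Real.logb 2 K ≤ Real.logb 2 ((n : ℝ) ^ (3 * T)) :=
        Real.logb_le_logb_of_le one_lt_two (by exact_mod_cast hK) (by exact_mod_cast hle)
    _ = 3 * T * Real.logb 2 n := by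
        rw [Real.logb_pow]
        push_cast
        ring

end Entropy

end QuantumDecisionTree

theorem proposition1 :
    ∃ c : ℝ, 0 < c ∧
      ∀ (n m : ℕ), 2 ≤ n →
        ∀ (A : Finset (QuantumDecisionTree.Bits n)) (f : A → QuantumDecisionTree.Bits m),
          ((c * (QuantumDecisionTree.entropy f / Real.logb 2 (n : ℝ)) : ℝ) : EReal) ≤
            ((QuantumDecisionTree.queryComplexity f : ℕ∞) : EReal) := by
  refine ⟨1 / 3, by norm_num, fun n m hn A f => ?_⟩
  have hlog : 0 < Real.logb 2 (n : ℝ) :=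
    Real.logb_pos one_lt_two (by exact_mod_cast hn)
  by_cases hcomp : ∃ T, QuantumDecisionTree.ComputableIn f T
  · have hinf : ∃ T, QuantumDecisionTree.ComputableIn f T ∧
        QuantumDecisionTree.queryComplexity f = (T : ℕ∞) := by
      classical
      refine ⟨Nat.find hcomp, Nat.find_spec hcomp, le_antisymm ?_ ?_⟩
      · exact iInf₂_le _ (Nat.find_spec hcomp)
      · exact le_iInf₂ fun T hT => by exact_mod_cast Nat.find_min' hcomp hT
    obtain ⟨T, hT, heq⟩ := hinf
    rw [heq]
    have h := QuantumDecisionTree.entropy_le_of_computableIn hn hT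
    have hreal : 1 / 3 * (QuantumDecisionTree.entropy f / Real.logb 2 (n : ℝ)) ≤ (T : ℝ) := by
      rw [← mul_div_assoc, div_le_iff₀ hlog]
      linarith
    have hcast : (((T : ℕ∞) : ENNReal) : EReal) = ((T : ℝ) : EReal) := by
      rw [ENat.toENNReal_coe, ← ENNReal.ofReal_natCast, EReal.coe_ennreal_ofReal,
        max_eq_left (Nat.cast_nonneg T)]
    rw [hcast]
    exact EReal.coe_le_coe_iff.mpr hreal
  · have htop : QuantumDecisionTree.queryComplexity f = ⊤ := by
      simp only [QuantumDecisionTree.queryComplexity, iInf_eq_top]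
      exact fun T hT => absurd ⟨T, hT⟩ hcomp
    rw [htop]
    exact le_top
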